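/- For a number field $K$ with ring of integers $\mathcal{O}_K$ and class group $Cl(K)$, and for a positive integer $l$, let $I_K^l$ be the product of all nonzero prime ideals of $\mathcal{O}_K$ of absolute norm $l$ (so $I_K^l=\mathcal{O}_K$ if there are none). The Pólya group $Po(K)$ is the subgroup of $Cl(K)$ generated by the classes of the ideals $I_K^l$, $l\ge 1$. For an extension $L/K$ of number fields, let $\varepsilon_K^L : Cl(K)\to Cl(L)$ be the homomorphism sending the class of an ideal $I$ to the class of $I\mathcal{O}_L$. Let $K_1$ and $K_2$ be finite Galois extensions of $\mathbb{Q}$ and let $L=K_1K_2$ be their compositum. Suppose that for every prime number $p$ at least one of $K_1/\mathbb{Q}$, $K_2/\mathbb{Q}$ is tamely ramified at $p$, that is, for some $i\in\{1,2\}$ the number $p$ divides none of the ramification indices over $\mathbb{Q}$ of the primes of $K_i$ above $p$ (unramified being allowed). Then $$Po(L)=\varepsilon_{K_1}^L(Po(K_1))\cdot \varepsilon_{K_2}^L(Po(K_2)).$$ -/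

import Mathlib

open scoped NumberField nonZeroDivisors

noncomputable section

/-- The set of nonzero prime ideals of `𝓞 K` of absolute norm `l`. -/
def primesOfNorm (K : Type*) [Field K] [NumberField K] (l : ℕ) : Set (Ideal (𝓞 K)) :=
  {P | P.IsPrime ∧ P ≠ ⊥ ∧ Ideal.absNorm P = l}

theorem primesOfNorm_finite (K : Type*) [Field K] [NumberField K] (l : ℕ) :
    (primesOfNorm K l).Finite :=
  (Ideal.finite_setOfPred_absNorm_eq (S := 𝓞 K) l).subset fun _ hP => hP.2.2

/-- The ideal `I_K^l`: the product of all prime ideals of `𝓞 K` of norm `l`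
(the unit ideal if there are none). -/
def polyaIdeal (K : Type*) [Field K] [NumberField K] (l : ℕ) : Ideal (𝓞 K) :=
  ∏ P ∈ (primesOfNorm_finite K l).toFinset, P

theorem polyaIdeal_mem_nonZeroDivisors (K : Type*) [Field K] [NumberField K] (l : ℕ) :
    polyaIdeal K l ∈ (Ideal (𝓞 K))⁰ := by
  refine mem_nonZeroDivisors_of_ne_zero (Finset.prod_ne_zero_iff.mpr fun P hP => ?_)
  exact ((primesOfNorm_finite K l).mem_toFinset.mp hP).2.1

/-- The Pólya group `Po(K)`: the subgroup of the class group of `K` generated by the classes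
of the ideals `I_K^l`, for `l` a positive integer. -/
def polyaGroup (K : Type*) [Field K] [NumberField K] : Subgroup (ClassGroup (𝓞 K)) :=
  Subgroup.closure
    {c | ∃ l : ℕ, 0 < l ∧
      c = ClassGroup.mk0 ⟨polyaIdeal K l, polyaIdeal_mem_nonZeroDivisors K l⟩}

/-- `K / ℚ` is tamely ramified at the prime number `p`: the ramification index over `ℤ` of every
prime ideal of `𝓞 K` above `p` is prime to `p` (unramified is included). The residue field
extensions are automatically separable, being extensions of finite fields. -/
def IsTamelyRamifiedAt (K : Type*) [Field K] [NumberField K] (p : ℕ) : Prop :=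
  ∀ P : Ideal (𝓞 K), P.IsPrime → P.LiesOver (Ideal.span {(p : ℤ)}) →
    ¬ p ∣ P.ramificationIdx ℤ

end

/-! ### Inertia groups acting on a Dedekind domain -/

section TameCharacter

open scoped Pointwise

variable {S G : Type*} [CommRing S] [Group G] [MulSemiringAction G S] {P : Ideal S}

/-! For a prime `Q` of `L`, extending to `L` the Pólya ideal of `Kᵢ` attached to the prime below `Q`
gives the `eᵢ`-th power of the Pólya ideal of `L` attached to `Q`, with `eᵢ = e(Q/Kᵢ)`
(`map_polyaIdeal`). If `e₁` and `e₂` are coprime, Bézout puts the class of the latter in the product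
of the two images.

For coprimality, `eᵢ` is the order of `I ∩ Nᵢ`, where `I` is the inertia group of `Q` and `Nᵢ =
Gal(L/Kᵢ)`; the `Nᵢ` are normal and meet trivially. Let a prime `q` divide both orders. If `q ≠ p`,
the tame character embeds elements of order `q` in the roots of unity of a field, so those of `I ∩
N₁` and `I ∩ N₂` generate the same subgroup, which is absurd. If `q = p` and `K₁` is tame at `p`,
then `I ∩ N₁` has index prime to `p` in `I`, which forces elements of order `p` of `I` into `N₁`. -/

theorem Ideal.smul_mem_pow_of_mem_inertia {σ : G} (hσ : σ ∈ P.inertia G) (n : ℕ) {x : S}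
    (hx : x ∈ P ^ n) : σ • x ∈ P ^ n := by
  have hP : σ • P = P := MulAction.mem_stabilizer_iff.mp (Ideal.inertia_le_stabilizer P hσ)
  have hPn : σ • (P ^ n) = P ^ n := by rw [smul_pow', hP]
  rw [← hPn]
  exact Ideal.smul_mem_pointwise_smul σ x _ hx

variable [IsDedekindDomain S]

/-- The tame character of the inertia group of a nonzero prime `P` of a Dedekind domain: an element
of the inertia group acts on `P / P ^ 2` through multiplication by a scalar. -/
theorem Ideal.exists_tameCharacter [P.IsPrime] (hP : P ≠ ⊥) :
    ∃ θ : P.inertia G →* S ⧸ P, ∀ (σ : P.inertia G) (a : S), Ideal.Quotient.mk P a = θ σ →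
      ∀ x ∈ P, (σ : G) • x - a * x ∈ P ^ 2 := by
  obtain ⟨π, hπ, hπ2⟩ := SetLike.exists_of_lt (Ideal.pow_succ_lt_pow hP 1)
  have hdec (c : S) (hc : c ∈ P) : ∃ d : S, ∃ e ∈ P ^ 2, π * d + e = c :=
    Ideal.exists_mul_add_mem_pow_succ hP π c hπ hπ2 (by simpa using hc)
  replace hπ : π ∈ P := by simpa using hπ
  replace hπ2 : π ∉ P ^ 2 := hπ2
  have hex (σ : P.inertia G) : ∃ a : S, (σ : G) • π - a * π ∈ P ^ 2 := by
    obtain ⟨d, e, he, h⟩ := hdec ((σ : G) • π)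
      (by simpa using Ideal.smul_mem_pow_of_mem_inertia σ.2 1 (by simpa using hπ))
    exact ⟨d, by rw [← h]; convert he using 1; ring⟩
  choose a ha using hex
  -- Since `π ∉ P ^ 2`, the scalar is determined modulo `P`; this makes `θ` multiplicative.
  have huniq (b c y : S) (hb : y - b * π ∈ P ^ 2) (hc : y - c * π ∈ P ^ 2) :
      Ideal.Quotient.mk P b = Ideal.Quotient.mk P c := by
    rw [Ideal.Quotient.eq]
    refine Ideal.mem_prime_of_mul_mem_pow (i := 1) hP hπ2 ?_
    convert sub_mem hc hb using 1
    ring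
  have hmul2 {x y : S} (hx : x ∈ P) (hy : y ∈ P) : x * y ∈ P ^ 2 := by
    rw [pow_two]; exact Ideal.mul_mem_mul hx hy
  have hscal (σ : P.inertia G) (b : S) (hb : (σ : G) • π - b * π ∈ P ^ 2) (x : S) (hx : x ∈ P) :
      (σ : G) • x - b * x ∈ P ^ 2 := by
    obtain ⟨d, e, he, rfl⟩ := hdec x hx
    have hd : (σ : G) • d - d ∈ P := σ.2 d
    have hse := Ideal.smul_mem_pow_of_mem_inertia σ.2 2 he
    have h1 := (P ^ 2).mul_mem_right ((σ : G) • d) hb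
    have h2 := (P ^ 2).mul_mem_left b (hmul2 hπ hd)
    have h3 := (P ^ 2).mul_mem_left b he
    rw [smul_add, smul_mul']
    convert add_mem (add_mem h1 h2) (sub_mem hse h3) using 1
    ring
  let θ : P.inertia G →* S ⧸ P :=
    { toFun := fun σ => Ideal.Quotient.mk P (a σ)
      map_one' := huniq _ 1 π (by simpa using ha 1) (by simp)
      map_mul' := fun σ τ => by
        rw [← map_mul]
        refine huniq _ _ _ (ha (σ * τ)) ?_
        have hτ : (τ : G) • π ∈ P := by
          simpa using Ideal.smul_mem_pow_of_mem_inertia τ.2 1 (by simpa using hπ)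
        have h1 := hscal σ (a σ) (ha σ) _ hτ
        have h2 := (P ^ 2).mul_mem_left (a σ) (ha τ)
        rw [Subgroup.coe_mul, mul_smul]
        convert add_mem h1 h2 using 1
        ring }
  refine ⟨θ, fun σ b hb => hscal σ b ?_⟩
  have hba : b - a σ ∈ P := Ideal.Quotient.eq.mp hb
  convert sub_mem (ha σ) (hmul2 hba hπ) using 1
  ring

/-- An automorphism of order prime to the residue characteristic which acts trivially on `S / P`
and on `P / P ^ 2` is trivial. -/
theorem eq_one_of_smul_sub_mem_sq [FaithfulSMul G S] [P.IsPrime] {σ : G}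
    (hσ : σ ∈ P.inertia G) (hσ2 : ∀ x ∈ P, σ • x - x ∈ P ^ 2) {m : ℕ} (hm : (m : S) ∉ P)
    (hσm : σ ^ m = 1) : σ = 1 := by
  by_cases hP : P = ⊥
  · refine FaithfulSMul.eq_of_smul_eq_smul (α := S) fun x => ?_
    have := hσ x
    subst hP
    simpa [sub_eq_zero] using this
  have hstep (n : ℕ) : ∀ x ∈ P ^ n, σ • x - x ∈ P ^ (n + 1) := by
    induction n with
    | zero => intro x _; simpa using hσ x
    | succ n ih =>
      intro x hx
      rw [pow_succ] at hx
      refine Submodule.mul_induction_on hx (fun y hy z hz => ?_) fun y z hy hz => ?_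
      · have h1 := Ideal.mul_mem_mul (ih y hy)
          (by simpa using Ideal.smul_mem_pow_of_mem_inertia hσ 1 (by simpa using hz))
        have h2 := Ideal.mul_mem_mul hy (hσ2 z hz)
        rw [← pow_succ] at h1
        rw [← pow_add] at h2
        rw [smul_mul']
        convert add_mem h1 h2 using 1
        ring
      · rw [smul_add]
        convert add_mem hy hz using 1
        ring
  have hall (x : S) (n : ℕ) : σ • x - x ∈ P ^ n := by
    induction n with
    | zero => simp
    | succ n ih =>
      set d := σ • x - x with hd
      -- By `hstep`, `σ` fixes `d` modulo `P ^ (n + 1)`, so its iterates translate `x` by multiples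
      -- of `d`; taking `k = m` gives `m * d ∈ P ^ (n + 1)`.
      have hpow (k : ℕ) : σ ^ k • x - (x + k * d) ∈ P ^ (n + 1) := by
        induction k with
        | zero => simp
        | succ k ihk =>
          have h1 := Ideal.smul_mem_pow_of_mem_inertia hσ (n + 1) ihk
          have h2 := (P ^ (n + 1)).mul_mem_left (k : S) (hstep n d ih)
          rw [smul_sub, smul_add, smul_mul', smul_smul, ← pow_succ',
            show σ • (k : S) = k from map_natCast (MulSemiringAction.toRingHom G S σ) k] at h1
          convert add_mem h1 h2 using 1
          push_cast
          rw [show σ • x = x + d by rw [hd]; ring]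
          ring
      have hmd : (m : S) * d ∈ P ^ (n + 1) := by
        have := hpow m
        rw [hσm, one_smul] at this
        convert neg_mem this using 1
        ring
      by_contra hcon
      exact hm (Ideal.mem_prime_of_mul_mem_pow hP hcon (by rwa [mul_comm]))
  refine FaithfulSMul.eq_of_smul_eq_smul (α := S) fun x => ?_
  have hmem : σ • x - x ∈ ⨅ n : ℕ, P ^ n := by
    simpa only [Submodule.mem_iInf] using hall x
  rw [Ideal.iInf_pow_eq_bot_of_isDomain P (Ideal.IsPrime.ne_top ‹_›)] at hmem
  rw [one_smul]
  exact sub_eq_zero.mp hmem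

/-- Away from the residue characteristic, a prime number cannot divide the orders of the traces on
the inertia group of two normal subgroups which meet trivially. -/
theorem not_dvd_card_inertia_inf_of_natCast_notMem [FaithfulSMul G S] [Finite G] [P.IsPrime]
    (hP : P ≠ ⊥) {N₁ N₂ : Subgroup G} [N₁.Normal] [N₂.Normal] (hN : Disjoint N₁ N₂) {q : ℕ}
    (hq : q.Prime) (hqP : (q : S) ∉ P)
    (h₁ : q ∣ Nat.card (P.inertia G ⊓ N₁ : Subgroup G)) :
    ¬ q ∣ Nat.card (P.inertia G ⊓ N₂ : Subgroup G) := by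
  intro h₂
  have := Fact.mk hq
  obtain ⟨θ, hθ⟩ := Ideal.exists_tameCharacter (G := G) hP
  have hker (σ : P.inertia G) (h : θ σ = 1) (hσ : σ ^ q = 1) : σ = 1 := by
    refine Subtype.ext (eq_one_of_smul_sub_mem_sq σ.2 (fun x hx => ?_) hqP ?_)
    · simpa using hθ σ 1 (by simp [h]) x hx
    · simpa using congrArg Subtype.val hσ
  have hcauchy (N : Subgroup G) (h : q ∣ Nat.card (P.inertia G ⊓ N : Subgroup G)) :
      ∃ σ : P.inertia G, (σ : G) ∈ N ∧ σ ^ q = 1 ∧ σ ≠ 1 := by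
    obtain ⟨σ, hσ⟩ := exists_prime_orderOf_dvd_card' q h
    refine ⟨⟨σ, σ.2.1⟩, σ.2.2, ?_, fun h1 => ?_⟩
    · ext
      have h1 : σ ^ q = 1 := hσ ▸ pow_orderOf_eq_one σ
      simpa only [Subgroup.coe_pow, Subgroup.coe_one] using congrArg Subtype.val h1
    · have h2 : σ = 1 := by ext; simpa using congrArg Subtype.val h1
      rw [h2, orderOf_one] at hσ
      exact hq.one_lt.ne hσ
  obtain ⟨x, hxN, hxq, hx1⟩ := hcauchy N₁ h₁
  obtain ⟨y, hyN, hyq, hy1⟩ := hcauchy N₂ h₂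
  -- In the domain `S ⧸ P`, every `q`-th root of unity is a power of a primitive one, so `θ x = θ y
  -- ^ k`.
  have hprim : IsPrimitiveRoot (θ y) q := by
    rw [IsPrimitiveRoot.iff_orderOf]
    exact orderOf_eq_prime (by rw [← map_pow, hyq, map_one]) fun h => hy1 (hker y h hyq)
  obtain ⟨k, -, hk⟩ := hprim.eq_pow_of_pow_eq_one
    (show θ x ^ q = 1 by rw [← map_pow, hxq, map_one])
  have hxy : Commute x y := Subtype.ext
    (Subgroup.commute_of_normal_of_disjoint N₁ N₂ inferInstance inferInstance hN x y hxN hyN)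
  have hz : x * (y ^ k)⁻¹ = 1 := by
    refine hker _ ?_ ?_
    · have h3 : θ (y ^ k) * θ (y ^ k)⁻¹ = 1 := by rw [← map_mul, mul_inv_cancel, map_one]
      rw [map_mul, ← hk, ← map_pow, h3]
    · rw [(hxy.pow_right k).inv_right.mul_pow, hxq, one_mul, inv_pow, ← pow_mul, mul_comm k,
        pow_mul, hyq, one_pow, inv_one]
  have hxyk : x = y ^ k := mul_inv_eq_one.mp hz
  refine hx1 (Subtype.ext (Subgroup.disjoint_def.mp hN hxN ?_))
  rw [hxyk, Subgroup.coe_pow]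
  exact pow_mem hyN k

/-- If `q` does not divide the index of `N₁ ⊓ H` in `H`, then it cannot divide the order of `N₂ ⊓ H`
when `N₁` is normal and meets `N₂` trivially. -/
theorem not_dvd_card_inf_of_disjoint {G : Type*} [Group G] [Finite G] {H N₁ N₂ : Subgroup G}
    [N₁.Normal] (hN : Disjoint N₁ N₂) {q e : ℕ} (hq : q.Prime) (hqe : ¬ q ∣ e)
    (he : e * Nat.card (H ⊓ N₁ : Subgroup G) = Nat.card H) :
    ¬ q ∣ Nat.card (H ⊓ N₂ : Subgroup G) := by
  intro h₂
  have := Fact.mk hq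
  obtain ⟨y, hy⟩ := exists_prime_orderOf_dvd_card' q h₂
  have hindex : (N₁.subgroupOf H).index = e := by
    have h := (N₁.subgroupOf H).card_mul_index
    rw [← he, ← Subgroup.inf_subgroupOf_left,
      Nat.card_congr (Subgroup.subgroupOfEquivOfLe inf_le_left).toEquiv, mul_comm,
      Subgroup.inf_subgroupOf_left] at h
    exact Nat.eq_of_mul_eq_mul_right Nat.card_pos h
  have hye : (y : G) ^ e ∈ N₁ := by
    have h := Subgroup.pow_index_mem (N₁.subgroupOf H) ⟨y, y.2.1⟩
    rw [hindex, Subgroup.mem_subgroupOf] at h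
    simpa using h
  have h1 : (y : G) ^ e = 1 := Subgroup.disjoint_def.mp hN hye (pow_mem y.2.2 e)
  refine hqe (hy ▸ orderOf_dvd_of_pow_eq_one (Subtype.ext ?_))
  simpa using h1

end TameCharacter

/-! ### Ramification indices as orders of inertia groups -/

section Inertia

variable {K L : Type*} [Field K] [Field L] [NumberField K] [NumberField L] [Algebra K L]

theorem card_inertia_eq_ramificationIdx [IsGalois K L] {Q : Ideal (𝓞 L)} [Q.IsPrime]
    (hQ : Q ≠ ⊥) : Nat.card (Q.inertia Gal(L/K)) = Q.ramificationIdx (𝓞 K) := by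
  have hbot : Q.under (𝓞 K) ≠ ⊥ := mt Ideal.eq_bot_of_comap_eq_bot hQ
  have : (Q.under (𝓞 K)).IsMaximal := Ideal.IsPrime.isMaximal inferInstance hbot
  have := Ideal.finiteQuotientOfFreeOfNeBot _ hbot
  rw [Ideal.card_inertia_eq_ramificationIdxIn (Q.under (𝓞 K)) Q,
    Ideal.ramificationIdxIn_eq_ramificationIdx (Q.under (𝓞 K)) Q Gal(L/K)]

theorem card_inertia_rat_eq_ramificationIdx [IsGalois ℚ L] {Q : Ideal (𝓞 L)} [Q.IsPrime]
    (hQ : Q ≠ ⊥) : Nat.card (Q.inertia Gal(L/ℚ)) = Q.ramificationIdx ℤ := by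
  have hbot : Q.under ℤ ≠ ⊥ := mt Ideal.eq_bot_of_comap_eq_bot hQ
  have : (Q.under ℤ).IsMaximal := Ideal.IsPrime.isMaximal inferInstance hbot
  have := Ideal.finiteQuotientOfFreeOfNeBot _ hbot
  rw [Ideal.card_inertia_eq_ramificationIdxIn (Q.under ℤ) Q,
    Ideal.ramificationIdxIn_eq_ramificationIdx (Q.under ℤ) Q Gal(L/ℚ)]

theorem mem_ker_restrictNormalHom_iff [Normal ℚ K] {σ : Gal(L/ℚ)} :
    σ ∈ (AlgEquiv.restrictNormalHom K).ker ↔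
      ∀ x : K, σ (algebraMap K L x) = algebraMap K L x := by
  rw [MonoidHom.mem_ker]
  refine ⟨fun h x => ?_, fun h => AlgEquiv.ext fun x => (algebraMap K L).injective ?_⟩
  · have := AlgEquiv.restrictNormal_commutes σ K x
    rw [← this]
    exact congrArg (algebraMap K L) (DFunLike.congr_fun h x)
  · exact (AlgEquiv.restrictNormal_commutes σ K x).trans (h x)

theorem card_inertia_inf_ker_restrictNormalHom [IsGalois ℚ K] [IsGalois ℚ L] {Q : Ideal (𝓞 L)} [Q.IsPrime]
    (hQ : Q ≠ ⊥) :
    Nat.card (Q.inertia Gal(L/ℚ) ⊓ (AlgEquiv.restrictNormalHom (F := ℚ) (K₁ := L) K).ker :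
      Subgroup Gal(L/ℚ)) = Q.ramificationIdx (𝓞 K) := by
  have : IsGalois K L := IsGalois.tower_top_of_isGalois ℚ K L
  rw [← card_inertia_eq_ramificationIdx (K := K) hQ,
    ← Subgroup.card_map_of_injective (K := Q.inertia Gal(L/K))
      (AlgEquiv.restrictScalarsHom_injective ℚ (S := K) (A := L))]
  congr! 2
  ext σ
  simp only [Subgroup.mem_inf, mem_ker_restrictNormalHom_iff, Subgroup.mem_map]
  constructor
  · rintro ⟨h1, h2⟩
    exact ⟨AlgEquiv.ofRingEquiv (f := σ.toRingEquiv) h2, h1, AlgEquiv.ext fun _ => rfl⟩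
  · rintro ⟨τ, hτ, rfl⟩
    exact ⟨hτ, fun x => τ.commutes x⟩

end Inertia

/-! ### Coprime ramification in the compositum -/

section Compositum

variable {K₁ K₂ L : Type*} [Field K₁] [Field K₂] [Field L]
  [NumberField K₁] [NumberField K₂] [NumberField L] [IsGalois ℚ K₁] [IsGalois ℚ K₂]
  [Algebra K₁ L] [Algebra K₂ L]

theorem isGalois_of_fieldRange_sup_fieldRange_eq_top
    (hL : (algebraMap K₁ L).fieldRange ⊔ (algebraMap K₂ L).fieldRange = ⊤) : IsGalois ℚ L := by
  let F₁ := (IsScalarTower.toAlgHom ℚ K₁ L).fieldRange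
  let F₂ := (IsScalarTower.toAlgHom ℚ K₂ L).fieldRange
  have h₁ : Normal ℚ F₁ :=
    Normal.of_algEquiv (AlgEquiv.ofInjectiveField (IsScalarTower.toAlgHom ℚ K₁ L))
  have h₂ : Normal ℚ F₂ :=
    Normal.of_algEquiv (AlgEquiv.ofInjectiveField (IsScalarTower.toAlgHom ℚ K₂ L))
  have htop : F₁ ⊔ F₂ = ⊤ := by
    rw [eq_top_iff]
    intro x _
    have hle : (algebraMap K₁ L).fieldRange ⊔ (algebraMap K₂ L).fieldRange ≤
        (F₁ ⊔ F₂).toSubfield :=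
      sup_le (fun y hy => (le_sup_left : F₁ ≤ F₁ ⊔ F₂) hy)
        fun y hy => (le_sup_right : F₂ ≤ F₁ ⊔ F₂) hy
    rw [hL] at hle
    exact hle trivial
  have hnormal := @IntermediateField.normal_sup ℚ L _ _ _ F₁ F₂ h₁ h₂
  rw [htop] at hnormal
  have : Normal ℚ L := @Normal.of_algEquiv _ _ _ _ _ _ _ _ hnormal IntermediateField.topEquiv
  exact ⟨⟩

theorem disjoint_ker_restrictNormalHom
    (hL : (algebraMap K₁ L).fieldRange ⊔ (algebraMap K₂ L).fieldRange = ⊤) :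
    Disjoint (AlgEquiv.restrictNormalHom (F := ℚ) (K₁ := L) K₁).ker
      (AlgEquiv.restrictNormalHom (F := ℚ) (K₁ := L) K₂).ker := by
  rw [Subgroup.disjoint_def]
  intro σ h₁ h₂
  rw [mem_ker_restrictNormalHom_iff] at h₁ h₂
  have hle : (algebraMap K₁ L).fieldRange ⊔ (algebraMap K₂ L).fieldRange ≤
      (σ : L →+* L).eqLocusField (RingHom.id L) := by
    refine sup_le ?_ ?_
    · rintro _ ⟨x, rfl⟩; exact h₁ x
    · rintro _ ⟨x, rfl⟩; exact h₂ x
  rw [hL] at hle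
  exact AlgEquiv.ext fun x => hle (x := x) trivial

theorem coprime_ramificationIdx_of_isTamelyRamifiedAt
    (hL : (algebraMap K₁ L).fieldRange ⊔ (algebraMap K₂ L).fieldRange = ⊤)
    {p : ℕ} (hp : p.Prime) (htame : IsTamelyRamifiedAt K₁ p) (Q : Ideal (𝓞 L)) [Q.IsPrime]
    [hQp : Q.LiesOver (Ideal.span {(p : ℤ)})] :
    (Q.ramificationIdx (𝓞 K₁)).Coprime (Q.ramificationIdx (𝓞 K₂)) := by
  have := isGalois_of_fieldRange_sup_fieldRange_eq_top hL
  have hN := disjoint_ker_restrictNormalHom hL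
  have hspan : Ideal.span {(p : ℤ)} ≠ ⊥ := by simpa using hp.ne_zero
  have hQ : Q ≠ ⊥ := Ideal.ne_bot_of_liesOver_of_ne_bot hspan Q
  rw [← card_inertia_inf_ker_restrictNormalHom (K := K₁) hQ,
    ← card_inertia_inf_ker_restrictNormalHom (K := K₂) hQ]
  refine Nat.coprime_of_dvd fun q hq h₁ => ?_
  by_cases hqp : q = p
  · subst hqp
    have hP : (Q.under (𝓞 K₁)).LiesOver (Ideal.span {(q : ℤ)}) :=
      Ideal.LiesOver.tower_bot Q (Q.under (𝓞 K₁)) _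
    -- The index of `I ∩ N₁` in `I` is the ramification index over `ℤ` of the prime of `K₁` below
    -- `Q`.
    refine not_dvd_card_inf_of_disjoint hN hq (htame (Q.under (𝓞 K₁)) inferInstance hP) ?_
    rw [card_inertia_inf_ker_restrictNormalHom hQ, card_inertia_rat_eq_ramificationIdx hQ,
      ← Ideal.ramificationIdx_tower]
  · have : FaithfulSMul Gal(L/ℚ) (𝓞 L) := (inferInstance : IsGaloisGroup Gal(L/ℚ) ℤ (𝓞 L)).faithful
    refine not_dvd_card_inertia_inf_of_natCast_notMem hQ hN hq (fun hmem => hqp ?_) h₁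
    have h : (q : ℤ) ∈ Q.under ℤ := by simpa [Ideal.mem_comap] using hmem
    rw [← hQp.over, Ideal.mem_span_singleton, Int.natCast_dvd_natCast] at h
    exact ((Nat.prime_dvd_prime_iff_eq hp hq).mp h).symm

end Compositum

/-! ### Pólya ideals under extension -/

section Polya

variable {K L : Type*} [Field K] [Field L] [NumberField K] [NumberField L] [Algebra K L]

theorem exists_liesOver_span_of_mem_primesOfNorm {l : ℕ} {P : Ideal (𝓞 K)}
    (hP : P ∈ primesOfNorm K l) :
    ∃ p : ℕ, p.Prime ∧ P.LiesOver (Ideal.span {(p : ℤ)}) := by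
  obtain ⟨hPp, hP0, -⟩ := hP
  have hbot : P.under ℤ ≠ ⊥ := mt Ideal.eq_bot_of_comap_eq_bot hP0
  have hprime : (P.under ℤ).IsPrime := inferInstance
  refine ⟨Ideal.absNorm (P.under ℤ), Int.prime_absNorm _ |>.mpr ?_, ⟨?_⟩⟩
  · exact Ideal.prime_of_isPrime hbot hprime
  · exact Int.ideal_span_absNorm_eq_self _

/-- A norm `p ^ f` determines `p`, and in a Galois extension all primes above `p` share the same
`f`. -/
theorem primesOfNorm_eq_primesOver [IsGalois ℚ K] {l p : ℕ} (hp : p.Prime) {P : Ideal (𝓞 K)}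
    (hP : P ∈ primesOfNorm K l) [P.LiesOver (Ideal.span {(p : ℤ)})] :
    primesOfNorm K l = (Ideal.span {(p : ℤ)}).primesOver (𝓞 K) := by
  obtain ⟨hPp, hP0, hPl⟩ := hP
  have hspan : Ideal.span {(p : ℤ)} ≠ ⊥ := by simpa using hp.ne_zero
  rw [← Ideal.pow_inertiaDeg p P] at hPl
  ext P'
  constructor
  · rintro ⟨hp', h0', hn'⟩
    obtain ⟨r, hr, hr'⟩ := exists_liesOver_span_of_mem_primesOfNorm ⟨hp', h0', hn'⟩
    refine ⟨hp', ?_⟩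
    suffices r = p from this ▸ hr'
    rw [← Ideal.pow_inertiaDeg r P', ← hPl] at hn'
    have h := dvd_of_eq hn'
    exact (Nat.prime_dvd_prime_iff_eq hr hp).mp (hr.dvd_of_dvd_pow
      ((dvd_pow_self r (Ideal.inertiaDeg_pos P' ℤ).ne').trans h))
  · rintro ⟨hp', hl'⟩
    refine ⟨hp', Ideal.ne_bot_of_liesOver_of_ne_bot hspan P', ?_⟩
    rw [← Ideal.pow_inertiaDeg p P', ← hPl,
      Ideal.inertiaDeg_eq_of_isGaloisGroup (Ideal.span {(p : ℤ)}) P P' Gal(K/ℚ)]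

theorem map_polyaIdeal [IsGalois ℚ K] [IsGalois ℚ L] {Q : Ideal (𝓞 L)} [Q.IsPrime] (hQ : Q ≠ ⊥) :
    (polyaIdeal K (Ideal.absNorm (Q.under (𝓞 K)))).map (algebraMap (𝓞 K) (𝓞 L)) =
      polyaIdeal L (Ideal.absNorm Q) ^ Q.ramificationIdx (𝓞 K) := by
  classical
  have hQmem : Q ∈ primesOfNorm L (Ideal.absNorm Q) := ⟨inferInstance, hQ, rfl⟩
  have hPbot : Q.under (𝓞 K) ≠ ⊥ := mt Ideal.eq_bot_of_comap_eq_bot hQ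
  have hPmem : Q.under (𝓞 K) ∈ primesOfNorm K (Ideal.absNorm (Q.under (𝓞 K))) :=
    ⟨inferInstance, hPbot, rfl⟩
  obtain ⟨p, hp, hQp⟩ := exists_liesOver_span_of_mem_primesOfNorm hQmem
  have hspan : Ideal.span {(p : ℤ)} ≠ ⊥ := by simpa using hp.ne_zero
  have hPp : (Q.under (𝓞 K)).LiesOver (Ideal.span {(p : ℤ)}) :=
    Ideal.LiesOver.tower_bot Q (Q.under (𝓞 K)) _
  have hL := primesOfNorm_eq_primesOver hp hQmem
  have hK := primesOfNorm_eq_primesOver hp hPmem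
  -- `Q'` and `Q` may lie over different primes of `K`, so the indices over `ℤ` are compared in `L`
  -- and in `K`, and the latter cancelled.
  have hram (Q' : Ideal (𝓞 L)) (hQ' : Q' ∈ primesOfNorm L (Ideal.absNorm Q)) :
      Q'.ramificationIdx (𝓞 K) = Q.ramificationIdx (𝓞 K) := by
    rw [hL] at hQ'
    obtain ⟨_, _⟩ := hQ'
    have : (Q'.under (𝓞 K)).LiesOver (Ideal.span {(p : ℤ)}) :=
      Ideal.LiesOver.tower_bot Q' (Q'.under (𝓞 K)) _
    have h := Ideal.ramificationIdx_eq_of_isGaloisGroup (Ideal.span {(p : ℤ)}) Q' Q Gal(L/ℚ)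
    rw [Ideal.ramificationIdx_tower (Q'.under (𝓞 K)) Q',
      Ideal.ramificationIdx_tower (Q.under (𝓞 K)) Q,
      Ideal.ramificationIdx_eq_of_isGaloisGroup (Ideal.span {(p : ℤ)})
        (Q'.under (𝓞 K)) (Q.under (𝓞 K)) Gal(K/ℚ)] at h
    exact Nat.eq_of_mul_eq_mul_left (Ideal.ramificationIdx_pos _ _) h
  have hmaps : ∀ Q' ∈ (primesOfNorm_finite L (Ideal.absNorm Q)).toFinset, Q'.under (𝓞 K) ∈
      (primesOfNorm_finite K (Ideal.absNorm (Q.under (𝓞 K)))).toFinset := by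
    intro Q' hQ'
    rw [Set.Finite.mem_toFinset, hL] at hQ'
    rw [Set.Finite.mem_toFinset, hK]
    obtain ⟨_, _⟩ := hQ'
    exact ⟨inferInstance, Ideal.LiesOver.tower_bot Q' (Q'.under (𝓞 K)) _⟩
  rw [polyaIdeal, polyaIdeal, ← Ideal.mapHom_apply, map_prod, ← Finset.prod_pow,
    ← Finset.prod_fiberwise_of_maps_to hmaps]
  refine Finset.prod_congr rfl fun P hP => ?_
  rw [Set.Finite.mem_toFinset] at hP
  obtain ⟨hPprime, hP0, -⟩ := id hP
  have : P.IsMaximal := hPprime.isMaximal hP0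
  rw [Ideal.mapHom_apply, Ideal.map_algebraMap_eq_finsetProd_pow hP0]
  refine Finset.prod_congr ?_ fun Q' hQ' => ?_
  · ext Q'
    simp only [Set.mem_toFinset, Finset.mem_filter, Set.Finite.mem_toFinset]
    rw [hL]
    rw [hK] at hP
    obtain ⟨_, _⟩ := hP
    constructor
    · rintro ⟨h1, h2⟩
      exact ⟨⟨h1, Ideal.LiesOver.trans Q' P _⟩, h2.over.symm⟩
    · rintro ⟨⟨h1, h2⟩, h3⟩
      exact ⟨h1, ⟨h3.symm⟩⟩
  · rw [hram Q' (by simpa using (Finset.mem_filter.mp hQ').1)]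

theorem extendedHom_mk0_polyaIdeal [IsGalois ℚ K] [IsGalois ℚ L] {Q : Ideal (𝓞 L)} [Q.IsPrime]
    (hQ : Q ≠ ⊥) :
    ClassGroup.extendedHom (𝓞 K) (𝓞 L) (ClassGroup.mk0
      ⟨polyaIdeal K (Ideal.absNorm (Q.under (𝓞 K))), polyaIdeal_mem_nonZeroDivisors K _⟩) =
    ClassGroup.mk0 ⟨polyaIdeal L (Ideal.absNorm Q), polyaIdeal_mem_nonZeroDivisors L _⟩ ^
      Q.ramificationIdx (𝓞 K) := by
  rw [ClassGroup.extendedHom_mk0, ← map_pow]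
  exact congrArg ClassGroup.mk0 (Subtype.ext (map_polyaIdeal hQ))

theorem mk0_polyaIdeal_eq_one {l : ℕ} (h : primesOfNorm K l = ∅) :
    ClassGroup.mk0 ⟨polyaIdeal K l, polyaIdeal_mem_nonZeroDivisors K l⟩ = 1 := by
  rw [← map_one ClassGroup.mk0]
  refine congrArg ClassGroup.mk0 (Subtype.ext ?_)
  exact Finset.prod_eq_one fun P hP => by simp [h] at hP

theorem mk0_polyaIdeal_mem_polyaGroup (l : ℕ) :
    ClassGroup.mk0 ⟨polyaIdeal K l, polyaIdeal_mem_nonZeroDivisors K l⟩ ∈ polyaGroup K := by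
  rcases (primesOfNorm K l).eq_empty_or_nonempty with h | ⟨P, -, hP0, hPl⟩
  · rw [mk0_polyaIdeal_eq_one h]
    exact one_mem _
  -- `l = 0` is excluded because only the zero ideal has norm `0`.
  · refine Subgroup.subset_closure ⟨l, Nat.pos_of_ne_zero fun hl => hP0 ?_, rfl⟩
    rwa [hl, Ideal.absNorm_eq_zero_iff] at hPl

theorem map_polyaGroup_le [IsGalois ℚ K] [IsGalois ℚ L] :
    (polyaGroup K).map (ClassGroup.extendedHom (𝓞 K) (𝓞 L)) ≤ polyaGroup L := by
  rw [polyaGroup, MonoidHom.map_closure, Subgroup.closure_le]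
  rintro _ ⟨_, ⟨l, -, rfl⟩, rfl⟩
  rw [SetLike.mem_coe]
  rcases (primesOfNorm K l).eq_empty_or_nonempty with h | ⟨P, hPprime, hP0, rfl⟩
  · rw [mk0_polyaIdeal_eq_one h, map_one]
    exact one_mem _
  · have : P.IsMaximal := hPprime.isMaximal hP0
    obtain ⟨Q, hQ, hQP⟩ := (inferInstance : Nonempty (P.primesOver (𝓞 L)))
    obtain rfl := hQP.over
    rw [extendedHom_mk0_polyaIdeal (Ideal.ne_bot_of_liesOver_of_ne_bot hP0 Q)]
    exact pow_mem (mk0_polyaIdeal_mem_polyaGroup _) _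

end Polya

theorem Subgroup.mem_of_pow_mem_of_pow_mem_of_coprime {G : Type*} [Group G] {H : Subgroup G}
    {x : G} {a b : ℕ} (hab : a.Coprime b) (ha : x ^ a ∈ H) (hb : x ^ b ∈ H) : x ∈ H := by
  have h := Nat.gcd_eq_gcd_ab a b
  rw [hab.gcd_eq_one] at h
  rw [← zpow_one x, ← Nat.cast_one, h, zpow_add, zpow_mul, zpow_mul, zpow_natCast, zpow_natCast]
  exact mul_mem (zpow_mem ha _) (zpow_mem hb _)

/-- `ClassGroup.extendedHom (𝓞 K) (𝓞 L)` is the map `Cl(K) → Cl(L)` induced by extension of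
ideals; the product of two subgroups of the abelian group `Cl(L)` is their supremum. -/
theorem corollary1p4 {K₁ K₂ L : Type*} [Field K₁] [Field K₂] [Field L]
    [NumberField K₁] [NumberField K₂] [NumberField L]
    [IsGalois ℚ K₁] [IsGalois ℚ K₂] [Algebra K₁ L] [Algebra K₂ L]
    (hL : (algebraMap K₁ L).fieldRange ⊔ (algebraMap K₂ L).fieldRange = ⊤)
    (htame : ∀ p : ℕ, p.Prime → IsTamelyRamifiedAt K₁ p ∨ IsTamelyRamifiedAt K₂ p) :
    polyaGroup L =
      (polyaGroup K₁).map (ClassGroup.extendedHom (𝓞 K₁) (𝓞 L)) ⊔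
        (polyaGroup K₂).map (ClassGroup.extendedHom (𝓞 K₂) (𝓞 L)) := by
  have := isGalois_of_fieldRange_sup_fieldRange_eq_top hL
  refine le_antisymm ?_ (sup_le map_polyaGroup_le map_polyaGroup_le)
  rw [polyaGroup, Subgroup.closure_le]
  rintro _ ⟨l, -, rfl⟩
  rw [SetLike.mem_coe]
  rcases (primesOfNorm L l).eq_empty_or_nonempty with h | ⟨Q, hQ⟩
  · rw [mk0_polyaIdeal_eq_one h]
    exact one_mem _
  obtain ⟨p, hp, hQp⟩ := exists_liesOver_span_of_mem_primesOfNorm hQ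
  obtain ⟨hQprime, hQ0, rfl⟩ := hQ
  have hcoprime : (Q.ramificationIdx (𝓞 K₁)).Coprime (Q.ramificationIdx (𝓞 K₂)) := by
    rcases htame p hp with h | h
    · exact coprime_ramificationIdx_of_isTamelyRamifiedAt hL hp h Q
    · exact (coprime_ramificationIdx_of_isTamelyRamifiedAt (by rwa [sup_comm]) hp h Q).symm
  refine Subgroup.mem_of_pow_mem_of_pow_mem_of_coprime hcoprime ?_ ?_
  · rw [← extendedHom_mk0_polyaIdeal hQ0]
    exact Subgroup.mem_sup_left (Subgroup.mem_map_of_mem _ (mk0_polyaIdeal_mem_polyaGroup _))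
  · rw [← extendedHom_mk0_polyaIdeal hQ0]
    exact Subgroup.mem_sup_right (Subgroup.mem_map_of_mem _ (mk0_polyaIdeal_mem_polyaGroup _))
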